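/- Let $m,n,k$ be positive integers with $k\le\min\{m,n\}$, let $A=[a_{ij}]\in\mathbb R^{m\times n}$, and let $W=[w_{ij}]\in\mathbb R^{m\times n}$ satisfy $w_{ij}>0$ for all $i,j$ and $\sum_{i,j}w_{ij}=1$. Put $w_0=\min_{i,j}w_{ij}$. Let $V_k(\mathbb R^d)=\{X\in\mathbb R^{d\times k}: X^{T}X=I_k\}$ be the Stiefel manifold, with tangent spaces $T_XV_k(\mathbb R^d)=\{Z\in\mathbb R^{d\times k}: X^TZ+Z^TX=0\}$, and let $M=V_k(\mathbb R^m)\times\mathbb R^k\times V_k(\mathbb R^n)$, a Riemannian submanifold of $\mathbb R^{m\times k}\times\mathbb R^k\times\mathbb R^{n\times k}$ with the product of the Frobenius and Euclidean inner products. Define $\hat G:M\to\mathbb R$ by $$\hat G(U,\mathbf x,V)=\sum_{i=1}^m\sum_{j=1}^n w_{ij}(a_{ij}-p_{ij})^2,\qquad P=[p_{ij}]=U\,\mathrm{diag}(\mathbf x)\,V^{T},$$ and let $\nabla\hat G$ be its Riemannian gradient. For a matrix $C$ with linearly independent columns let $\mathrm{qf}(C)$ be the factor $Q$ of its decomposition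 $C=QR$ with $Q^TQ=I_k$ and $R$ upper triangular with positive diagonal, and let $$R_{(U,\mathbf x,V)}(Y,\mathbf y,Z)=(\mathrm{qf}(U+Y),\ \mathbf x+\mathbf y,\ \mathrm{qf}(V+Z))$$ for $(Y,\mathbf y,Z)$ tangent to $M$ at $(U,\mathbf x,V)$. Fix $\overline\alpha>0$ and $\beta,\iota\in(0,1)$. For $z\in M$ let $\tau^A(z)=\beta^N\overline\alpha$ be the Armijo step size for the direction $\eta=-\nabla\hat G(z)$, where $N$ is the smallest non-negative integer with $$\hat G(z)-\hat G\bigl(R_z(\beta^N\overline\alpha\,\eta)\bigr)\ \ge\ -\iota\,\bigl\langle\nabla\hat G(z),\beta^N\overline\alpha\,\eta\bigr\rangle .$$ Let $z_t=(U_t,\mathbf x_t,V_t)\in M$, $t=0,1,2,\dots$, be any sequence produced by the accelerated line search, that is, $z_0\in M$ is arbitrary and for all $t\ge0$ $$\hat G(z_t)-\hat G(z_{t+1})\ \ge\ \hat G(z_t)-\hat G\bigl(R_{z_t}(-\tau^A(z_t)\nabla\hat G(z_t))\bigr).$$ Then: 1. For every $c\in\mathbb R$ the sublevel set $\{z\in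 M:\hat G(z)\le c\}$ is compact, and each of its points $(U,\mathbf x,V)$ satisfies $\|\mathbf x\|\le\|A\|_F+\sqrt{c/w_0}$. In particular this holds with $c=\hat G(U_0,\mathbf x_0,V_0)$. 2. $\lim_{t\to\infty}\|\nabla\hat G(U_t,\mathbf x_t,V_t)\|=0$. 3. $\{(U_t,\mathbf x_t,V_t)\}_{t\ge0}$ has a subsequence that converges to a critical point of $\hat G$. -/

import Mathlib

namespace StiefelWLRA

open scoped RealInnerProductSpace

/-- The Euclidean space `ℝ^{m×k} × ℝ^k × ℝ^{n×k}`, stored by its coordinates. Its inner product is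
the sum of the Frobenius inner product on `ℝ^{m×k}`, the dot product on `ℝ^k` and the Frobenius
inner product on `ℝ^{n×k}`. -/
abbrev Ambient (m n k : ℕ) : Type :=
  EuclideanSpace ℝ ((Fin m × Fin k) ⊕ (Fin k ⊕ (Fin n × Fin k)))

variable {m n k : ℕ}

/-- The component `U ∈ ℝ^{m×k}` of `(U, x, V)`. -/
def compU (p : Ambient m n k) : Matrix (Fin m) (Fin k) ℝ :=
  Matrix.of fun i l => p (Sum.inl (i, l))

/-- The component `x ∈ ℝ^k` of `(U, x, V)`. -/
def compX (p : Ambient m n k) : EuclideanSpace ℝ (Fin k) :=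
  WithLp.toLp 2 fun l => p (Sum.inr (Sum.inl l))

/-- The component `V ∈ ℝ^{n×k}` of `(U, x, V)`. -/
def compV (p : Ambient m n k) : Matrix (Fin n) (Fin k) ℝ :=
  Matrix.of fun j l => p (Sum.inr (Sum.inr (j, l)))

/-- The triple `(U, x, V)`. -/
def mkTriple (U : Matrix (Fin m) (Fin k) ℝ) (x : EuclideanSpace ℝ (Fin k))
    (V : Matrix (Fin n) (Fin k) ℝ) : Ambient m n k :=
  WithLp.toLp 2 (Sum.elim (fun q => U q.1 q.2) (Sum.elim (fun l => x l) (fun q => V q.1 q.2)))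

/-- The Stiefel manifold `V_k(ℝ^d) = {X ∈ ℝ^{d×k} | XᵀX = I_k}`. -/
def stiefel (d k : ℕ) : Set (Matrix (Fin d) (Fin k) ℝ) :=
  {X | X.transpose * X = 1}

/-- The manifold `V_k(ℝ^m) × ℝ^k × V_k(ℝ^n)`, a subset of the ambient Euclidean space. -/
def searchSpace (m n k : ℕ) : Set (Ambient m n k) :=
  {p | compU p ∈ stiefel m k ∧ compV p ∈ stiefel n k}

/-- The tangent space `T_U V_k(ℝ^m) × ℝ^k × T_V V_k(ℝ^n)` at `(U, x, V)`, where
`T_X V_k(ℝ^d) = {Z ∈ ℝ^{d×k} | XᵀZ + ZᵀX = 0}`. -/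
def tangentAt (p : Ambient m n k) : Submodule ℝ (Ambient m n k) where
  carrier := {ξ | (compU p).transpose * compU ξ + (compU ξ).transpose * compU p = 0 ∧
    (compV p).transpose * compV ξ + (compV ξ).transpose * compV p = 0}
  add_mem' := by
    rintro a b ⟨ha, ha'⟩ ⟨hb, hb'⟩
    have hU : compU (a + b) = compU a + compU b := rfl
    have hV : compV (a + b) = compV a + compV b := rfl
    refine ⟨?_, ?_⟩
    · rw [hU, Matrix.mul_add, Matrix.transpose_add, Matrix.add_mul, add_add_add_comm, ha, hb,
        add_zero]
    · rw [hV, Matrix.mul_add, Matrix.transpose_add, Matrix.add_mul, add_add_add_comm, ha', hb',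
        add_zero]
  zero_mem' := by
    have hU : compU (0 : Ambient m n k) = 0 := rfl
    have hV : compV (0 : Ambient m n k) = 0 := rfl
    refine ⟨?_, ?_⟩
    · simp [hU]
    · simp [hV]
  smul_mem' := by
    rintro c a ⟨ha, ha'⟩
    have hU : compU (c • a) = c • compU a := rfl
    have hV : compV (c • a) = c • compV a := rfl
    refine ⟨?_, ?_⟩
    · rw [hU, Matrix.mul_smul, Matrix.transpose_smul, Matrix.smul_mul, ← smul_add, ha, smul_zero]
    · rw [hV, Matrix.mul_smul, Matrix.transpose_smul, Matrix.smul_mul, ← smul_add, ha', smul_zero]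

/-- The Riemannian gradient at `p` of the restriction of `f` to the Riemannian submanifold
`V_k(ℝ^m) × ℝ^k × V_k(ℝ^n)` of the ambient Euclidean space: the orthogonal projection of the
Euclidean gradient of `f` onto the tangent space at `p`. -/
noncomputable def riemGrad (f : Ambient m n k → ℝ) (p : Ambient m n k) : Ambient m n k :=
  (tangentAt p).starProjection (gradient f p)

theorem riemGrad_mem (f : Ambient m n k → ℝ) (p : Ambient m n k) :
    riemGrad f p ∈ tangentAt p :=
  Submodule.starProjection_apply_mem _ _

/-- The Riemannian gradient is the tangent vector that represents the differential on the tangent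
space. -/
theorem inner_riemGrad (f : Ambient m n k → ℝ) (p : Ambient m n k) {v : Ambient m n k}
    (hv : v ∈ tangentAt p) : ⟪riemGrad f p, v⟫ = fderiv ℝ f p v := by
  have h : (tangentAt p).starProjection v = v := Submodule.starProjection_eq_self_iff.2 hv
  rw [riemGrad, Submodule.inner_starProjection_left_eq_right, h, gradient,
    InnerProductSpace.toDual_symm_apply]

/-- `p` is a critical point of the restriction of `f` to `V_k(ℝ^m) × ℝ^k × V_k(ℝ^n)`. -/
def IsCriticalPoint (f : Ambient m n k → ℝ) (p : Ambient m n k) : Prop :=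
  p ∈ searchSpace m n k ∧ riemGrad f p = 0

/-- The columns of a matrix, as vectors of a Euclidean space. -/
def column {d : ℕ} (C : Matrix (Fin d) (Fin k) ℝ) (l : Fin k) : EuclideanSpace ℝ (Fin d) :=
  WithLp.toLp 2 fun i => C i l

/-- The factor `Q` of the decomposition `C = QR` of a matrix with linearly independent columns,
where `QᵀQ = I_k` and `R` is upper triangular with positive diagonal. It is obtained by the
Gram-Schmidt process on the columns of `C`, followed by normalization. -/
noncomputable def qf {d : ℕ} (C : Matrix (Fin d) (Fin k) ℝ) : Matrix (Fin d) (Fin k) ℝ :=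
  Matrix.of fun i l => InnerProductSpace.gramSchmidtNormed ℝ (column C) l i

/-- `qf C` is the orthonormal factor of a `QR` decomposition of `C`. -/
theorem qf_spec {d : ℕ} (C : Matrix (Fin d) (Fin k) ℝ) (hC : LinearIndependent ℝ (column C)) :
    qf C ∈ stiefel d k ∧ ∃ R : Matrix (Fin k) (Fin k) ℝ,
      (∀ i j, j < i → R i j = 0) ∧ (∀ i, 0 < R i i) ∧ C = qf C * R := by
  have hne : ∀ i, InnerProductSpace.gramSchmidt ℝ (column C) i ≠ 0 := fun i =>
    InnerProductSpace.gramSchmidt_ne_zero i hC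
  have horth := InnerProductSpace.gramSchmidtNormed_orthonormal (𝕜 := ℝ) hC
  have hdec : ∀ j, column C j = ∑ i, ⟪InnerProductSpace.gramSchmidtNormed ℝ (column C) i,
      column C j⟫ • InnerProductSpace.gramSchmidtNormed ℝ (column C) i := by
    intro j
    have hmem : column C j ∈ Submodule.span ℝ
        (Set.range (InnerProductSpace.gramSchmidtNormed ℝ (column C))) := by
      rw [InnerProductSpace.span_gramSchmidtNormed_range, InnerProductSpace.span_gramSchmidt]
      exact Submodule.subset_span ⟨j, rfl⟩
    obtain ⟨a, ha⟩ := (Submodule.mem_span_range_iff_exists_fun ℝ).1 hmem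
    rw [← ha]
    refine Finset.sum_congr rfl fun i _ => ?_
    rw [horth.inner_right_fintype]
  refine ⟨?_, Matrix.of fun i j => ⟪InnerProductSpace.gramSchmidtNormed ℝ (column C) i,
    column C j⟫, ?_, ?_, ?_⟩
  · ext i j
    have h := orthonormal_iff_ite.1 horth j i
    rw [PiLp.inner_apply] at h
    simpa [Matrix.mul_apply, Matrix.one_apply, qf, eq_comm] using h
  · intro i j hij
    simp [InnerProductSpace.gramSchmidtNormed, real_inner_smul_left,
      InnerProductSpace.gramSchmidt_inv_triangular ℝ (column C) hij]
  · intro i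
    have hi : ⟪InnerProductSpace.gramSchmidt ℝ (column C) i, column C i⟫ =
        ‖InnerProductSpace.gramSchmidt ℝ (column C) i‖ ^ 2 := by
      conv_lhs => rw [InnerProductSpace.gramSchmidt_def'' ℝ (column C) i]
      rw [inner_add_right, inner_sum, Finset.sum_eq_zero, add_zero, real_inner_self_eq_norm_sq]
      intro l hl
      rw [inner_smul_right, InnerProductSpace.gramSchmidt_orthogonal ℝ (column C)
        (Finset.mem_Iio.1 hl).ne', mul_zero]
    have hpos := norm_pos_iff.2 (hne i)
    simp only [Matrix.of_apply, InnerProductSpace.gramSchmidtNormed, real_inner_smul_left, hi]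
    simp only [RCLike.ofReal_real_eq_id, id]
    positivity
  · ext i j
    have h := congrArg (fun v : EuclideanSpace ℝ (Fin d) => v i) (hdec j)
    simpa [Matrix.mul_apply, column, qf, mul_comm] using h

/-- The retraction `R_{(U,x,V)}(Y, y, Z) = (qf(U + Y), x + y, qf(V + Z))`. -/
noncomputable def retract (p ξ : Ambient m n k) : Ambient m n k :=
  mkTriple (qf (compU p + compU ξ)) (compX p + compX ξ) (qf (compV p + compV ξ))

/-- The non-negative integers `N` with
`f(p) - f(R_p(β^N ᾱ η)) ≥ -ι ⟨∇f(p), β^N ᾱ η⟩`. -/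
def armijoExponents (f : Ambient m n k → ℝ) (α β ι : ℝ) (p η : Ambient m n k) : Set ℕ :=
  {N | f p - f (retract p ((β ^ N * α) • η)) ≥ -ι * ⟪riemGrad f p, (β ^ N * α) • η⟫}

/-- The Armijo step size `β^N ᾱ`, for the smallest `N` in `armijoExponents`. -/
noncomputable def armijoStep (f : Ambient m n k → ℝ) (α β ι : ℝ) (p η : Ambient m n k) : ℝ :=
  β ^ sInf (armijoExponents f α β ι p η) * α

/-- `z` is a sequence of iterates in `V_k(ℝ^m) × ℝ^k × V_k(ℝ^n)` of the accelerated line search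
for `f` in the direction of the negative gradient, with parameters `ᾱ`, `β`, `ι`: every iterate
decreases `f` by at least as much as the Armijo point does. -/
def IsLineSearchSequence (f : Ambient m n k → ℝ) (α β ι : ℝ) (z : ℕ → Ambient m n k) : Prop :=
  (∀ t, z t ∈ searchSpace m n k) ∧
  ∀ t, f (z t) - f (z (t + 1)) ≥ f (z t) - f (retract (z t)
    (-(armijoStep f α β ι (z t) (-riemGrad f (z t))) • riemGrad f (z t)))

/-- The weighted cost `F̂(P) = ∑ᵢⱼ wᵢⱼ (aᵢⱼ - pᵢⱼ)²`. -/
def costF (A W P : Matrix (Fin m) (Fin n) ℝ) : ℝ :=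
  ∑ i, ∑ j, W i j * (A i j - P i j) ^ 2

/-- The cost `Ĝ(U, x, V) = F̂(U D(x) Vᵀ)`, where `D(x)` is the diagonal matrix with diagonal `x`. -/
def costG (A W : Matrix (Fin m) (Fin n) ℝ) (p : Ambient m n k) : ℝ :=
  costF A W (compU p * Matrix.diagonal (fun l => compX p l) * (compV p).transpose)

/-- The Frobenius norm. -/
noncomputable def frobNorm (A : Matrix (Fin m) (Fin n) ℝ) : ℝ :=
  √(∑ i, ∑ j, A i j ^ 2)

/-- The smallest weight `w₀`. -/
noncomputable def minWeight (W : Matrix (Fin m) (Fin n) ℝ) : ℝ :=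
  ⨅ q : Fin m × Fin n, W q.1 q.2

end StiefelWLRA

namespace StiefelWLRA

open scoped RealInnerProductSpace

variable {m n k : ℕ}

/-! ### The cost function -/

/-! Since `U` and `V` have orthonormal columns, `P = U D(x) Vᵀ` has Frobenius norm `‖x‖`. As all
weights are at least `w₀ > 0`, a bound on the cost bounds `‖A - P‖` and hence `‖x‖`; sublevel sets
are therefore closed and bounded (`norm_compX_le`, `isCompact_sublevel`).

For convergence, the key fact is that the QR retraction satisfies `R_p(ξ) = p + ξ + O(‖ξ‖²)` for
every tangent `ξ` (`exists_norm_retract_sub_le`). With the Taylor estimate for a C² function this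
gives `f(R_p(ξ)) ≤ f(p) + ⟨grad f(p), ξ⟩ + C‖ξ‖²`, uniformly over a compact set and bounded `ξ`
(`exists_retract_le`). Every step of length at most `(1 - ι)/C` then passes the Armijo test, so
backtracking stops at a step bounded below, and each iteration lowers the cost by at least `δ‖grad
f‖²` (`exists_armijo_decrease`). The cost is nonnegative, so the gradients tend to zero.

The iterates stay in the initial sublevel set; compactness yields a convergent subsequence, and
`isCriticalPoint_of_tendsto` shows that its limit is critical. -/

theorem costG_eq (A W : Matrix (Fin m) (Fin n) ℝ) (p : Ambient m n k) :
    costG A W p = ∑ i, ∑ j, W i j * (A i j -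
      ∑ l, p (Sum.inl (i, l)) * p (Sum.inr (Sum.inl l)) * p (Sum.inr (Sum.inr (j, l)))) ^ 2 := by
  simp [costG, costF, Matrix.mul_apply, Matrix.diagonal, compU, compX, compV]

theorem contDiff_costG (A W : Matrix (Fin m) (Fin n) ℝ) :
    ContDiff ℝ 2 (costG A W : Ambient m n k → ℝ) := by
  have : (costG A W : Ambient m n k → ℝ) = fun p => _ := funext (costG_eq A W)
  rw [this]
  fun_prop

theorem costG_nonneg {A W : Matrix (Fin m) (Fin n) ℝ} (hW : ∀ i j, 0 < W i j)
    (p : Ambient m n k) : 0 ≤ costG A W p := by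
  unfold costG costF
  exact Finset.sum_nonneg fun i _ => Finset.sum_nonneg fun j _ =>
    mul_nonneg (hW i j).le (sq_nonneg _)

theorem continuous_compU : Continuous (compU : Ambient m n k → _) := by
  unfold compU; fun_prop

theorem continuous_compV : Continuous (compV : Ambient m n k → _) := by
  unfold compV; fun_prop

theorem isClosed_searchSpace : IsClosed (searchSpace m n k) := by
  refine IsClosed.and ?_ ?_
  · exact isClosed_eq (continuous_compU.matrix_transpose.matrix_mul continuous_compU)
      continuous_const
  · exact isClosed_eq (continuous_compV.matrix_transpose.matrix_mul continuous_compV)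
      continuous_const

/-! ### Norms -/

theorem sum_sq_eq_trace {a b : ℕ} (X : Matrix (Fin a) (Fin b) ℝ) :
    ∑ i, ∑ j, X i j ^ 2 = (X.transpose * X).trace := by
  simp only [Matrix.trace, Matrix.diag, Matrix.mul_apply, Matrix.transpose_apply]
  rw [Finset.sum_comm]
  simp [sq]

theorem frobNorm_eq_norm (A : Matrix (Fin m) (Fin n) ℝ) :
    frobNorm A = ‖(WithLp.toLp 2 fun q => A q.1 q.2 : EuclideanSpace ℝ (Fin m × Fin n))‖ := by
  simp [frobNorm, EuclideanSpace.norm_eq, Fintype.sum_prod_type]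

theorem frobNorm_le_add_sub (A B : Matrix (Fin m) (Fin n) ℝ) :
    frobNorm B ≤ frobNorm A + frobNorm (A - B) := by
  simp only [frobNorm_eq_norm]
  exact norm_le_norm_add_norm_sub
    (WithLp.toLp 2 fun q : Fin m × Fin n => A q.1 q.2) (WithLp.toLp 2 fun q => B q.1 q.2)

theorem sum_sq_of_mem_stiefel {d : ℕ} {X : Matrix (Fin d) (Fin k) ℝ} (hX : X ∈ stiefel d k) :
    ∑ i, ∑ j, X i j ^ 2 = k := by
  rw [sum_sq_eq_trace, show X.transpose * X = 1 from hX]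
  simp

/-- Multiplication by matrices with orthonormal columns preserves the Frobenius norm. -/
theorem frobNorm_mul_diagonal_mul {U : Matrix (Fin m) (Fin k) ℝ} {V : Matrix (Fin n) (Fin k) ℝ}
    (hU : U ∈ stiefel m k) (hV : V ∈ stiefel n k) (x : EuclideanSpace ℝ (Fin k)) :
    frobNorm (U * Matrix.diagonal (fun l => x l) * V.transpose) = ‖x‖ := by
  have hU' : U.transpose * U = 1 := hU
  have hV' : V.transpose * V = 1 := hV
  have h : (U * Matrix.diagonal (fun l => x l) * V.transpose).transpose *
      (U * Matrix.diagonal (fun l => x l) * V.transpose) =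
      V * (Matrix.diagonal (fun l => x l) * Matrix.diagonal (fun l => x l) * V.transpose) := by
    simp only [Matrix.transpose_mul, Matrix.transpose_transpose, Matrix.diagonal_transpose,
      Matrix.mul_assoc]
    rw [← Matrix.mul_assoc U.transpose U, hU', Matrix.one_mul]
  rw [frobNorm, sum_sq_eq_trace, h, Matrix.trace_mul_comm, Matrix.mul_assoc, hV', Matrix.mul_one,
    EuclideanSpace.norm_eq]
  simp [Matrix.trace, sq]

theorem norm_sq_ambient (p : Ambient m n k) :
    ‖p‖ ^ 2 = ∑ i, ∑ l, compU p i l ^ 2 + (‖compX p‖ ^ 2 + ∑ j, ∑ l, compV p j l ^ 2) := by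
  simp [EuclideanSpace.norm_sq_eq, Fintype.sum_prod_type, compU, compX, compV]

theorem norm_sq_of_mem_searchSpace {p : Ambient m n k} (hp : p ∈ searchSpace m n k) :
    ‖p‖ ^ 2 = k + (‖compX p‖ ^ 2 + k) := by
  rw [norm_sq_ambient, sum_sq_of_mem_stiefel hp.1, sum_sq_of_mem_stiefel hp.2]

theorem sum_compU_sq_le (p : Ambient m n k) : ∑ i, ∑ l, compU p i l ^ 2 ≤ ‖p‖ ^ 2 := by
  rw [norm_sq_ambient]
  have : 0 ≤ ∑ j, ∑ l, compV p j l ^ 2 := by positivity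
  have : 0 ≤ ‖compX p‖ ^ 2 := by positivity
  linarith

theorem sum_compV_sq_le (p : Ambient m n k) : ∑ j, ∑ l, compV p j l ^ 2 ≤ ‖p‖ ^ 2 := by
  rw [norm_sq_ambient]
  have : 0 ≤ ∑ i, ∑ l, compU p i l ^ 2 := by positivity
  have : 0 ≤ ‖compX p‖ ^ 2 := by positivity
  linarith

/-! ### Sublevel sets -/

theorem minWeight_le (W : Matrix (Fin m) (Fin n) ℝ) (i : Fin m) (j : Fin n) :
    minWeight W ≤ W i j :=
  ciInf_le (Set.finite_range fun q : Fin m × Fin n => W q.1 q.2).bddBelow (i, j)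

theorem minWeight_pos [NeZero m] [NeZero n] {W : Matrix (Fin m) (Fin n) ℝ}
    (hW : ∀ i j, 0 < W i j) : 0 < minWeight W := by
  obtain ⟨q, hq⟩ := exists_eq_ciInf_of_finite (f := fun q : Fin m × Fin n => W q.1 q.2)
  rw [minWeight, ← hq]
  exact hW _ _

/-- Triangle inequality for `P = A - (A - P)`, with `‖P‖ = ‖x‖` and `w₀ ‖A - P‖²` at most the
weighted cost. -/
theorem norm_compX_le [NeZero m] [NeZero n] (A : Matrix (Fin m) (Fin n) ℝ)
    {W : Matrix (Fin m) (Fin n) ℝ} (hW : ∀ i j, 0 < W i j) {p : Ambient m n k}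
    (hp : p ∈ searchSpace m n k) {c : ℝ} (hc : costG A W p ≤ c) :
    ‖compX p‖ ≤ frobNorm A + √(c / minWeight W) := by
  rw [← frobNorm_mul_diagonal_mul hp.1 hp.2]
  refine (frobNorm_le_add_sub A _).trans (add_le_add_right (Real.sqrt_le_sqrt ?_) _)
  rw [le_div_iff₀ (minWeight_pos hW), mul_comm]
  refine le_trans ?_ hc
  simp only [Finset.mul_sum, costG, costF]
  refine Finset.sum_le_sum fun i _ => Finset.sum_le_sum fun j _ => ?_
  exact mul_le_mul_of_nonneg_right (minWeight_le W i j) (sq_nonneg _)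

/-- The Stiefel factors contribute exactly `2k` to `‖p‖²`, so only the component `x` needs a bound.
-/
theorem isCompact_sublevel [NeZero m] [NeZero n] (A : Matrix (Fin m) (Fin n) ℝ)
    {W : Matrix (Fin m) (Fin n) ℝ} (hW : ∀ i j, 0 < W i j) (c : ℝ) :
    IsCompact {p ∈ searchSpace m n k | costG A W p ≤ c} := by
  refine Metric.isCompact_of_isClosed_isBounded
    (isClosed_searchSpace.inter (isClosed_le (contDiff_costG A W).continuous continuous_const)) ?_
  refine isBounded_iff_forall_norm_le.2
    ⟨√(k + ((frobNorm A + √(c / minWeight W)) ^ 2 + k)), fun p hp => Real.le_sqrt_of_sq_le ?_⟩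
  rw [norm_sq_of_mem_searchSpace hp.1]
  have := norm_compX_le A hW hp.1 hp.2
  gcongr

/-! ### The QR retraction to second order -/

theorem abs_le_one_of_mem_stiefel {d : ℕ} {X : Matrix (Fin d) (Fin k) ℝ} (hX : X ∈ stiefel d k)
    (i : Fin d) (l : Fin k) : |X i l| ≤ 1 := by
  have h := congrFun (congrFun (show X.transpose * X = 1 from hX) l) l
  simp only [Matrix.mul_apply, Matrix.transpose_apply, Matrix.one_apply_eq, ← sq] at h
  rw [← sq_le_one_iff_abs_le_one, ← h]
  exact Finset.single_le_sum (f := fun i => X i l ^ 2) (fun _ _ => sq_nonneg _)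
    (Finset.mem_univ i)

theorem abs_transpose_mul_self_le {d : ℕ} (Y : Matrix (Fin d) (Fin k) ℝ) (j l : Fin k) :
    |(Y.transpose * Y) j l| ≤ ∑ i, ∑ l, Y i l ^ 2 := by
  simp only [Matrix.mul_apply, Matrix.transpose_apply]
  refine (Finset.abs_sum_le_sum_abs _ _).trans (Finset.sum_le_sum fun i _ => ?_)
  -- Each square is compared with the whole row sum separately, so that `|ab| ≤ (a² + b²)/2` also
  -- covers `j = l`.
  have hj : Y i j ^ 2 ≤ ∑ l, Y i l ^ 2 :=
    Finset.single_le_sum (f := fun l => Y i l ^ 2) (fun _ _ => sq_nonneg _) (Finset.mem_univ j)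
  have hl : Y i l ^ 2 ≤ ∑ l, Y i l ^ 2 :=
    Finset.single_le_sum (f := fun l => Y i l ^ 2) (fun _ _ => sq_nonneg _) (Finset.mem_univ l)
  rw [abs_le]
  constructor <;> nlinarith [sq_nonneg (Y i j + Y i l), sq_nonneg (Y i j - Y i l)]

/-- Tangency is exactly the vanishing of the first-order terms of the Gram matrix. -/
theorem transpose_mul_self_add {d : ℕ} {X Y : Matrix (Fin d) (Fin k) ℝ} (hX : X ∈ stiefel d k)
    (hY : X.transpose * Y + Y.transpose * X = 0) :
    (X + Y).transpose * (X + Y) = 1 + Y.transpose * Y := by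
  have hX' : X.transpose * X = 1 := hX
  rw [Matrix.transpose_add, Matrix.add_mul, Matrix.mul_add, Matrix.mul_add, hX']
  calc _ = 1 + (X.transpose * Y + Y.transpose * X) + Y.transpose * Y := by abel
    _ = _ := by rw [hY, add_zero]

/-- The Gram matrix `1 + YᵀY` is positive definite, so the QR factor is meaningful for every tangent
`Y`, however large. -/
theorem linearIndependent_column_add {d : ℕ} {X Y : Matrix (Fin d) (Fin k) ℝ}
    (hX : X ∈ stiefel d k) (hY : X.transpose * Y + Y.transpose * X = 0) :
    LinearIndependent ℝ (column (X + Y)) := by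
  rw [Fintype.linearIndependent_iff]
  intro g hg
  have h0 : (X + Y).mulVec g = 0 := by
    ext i
    have := congrArg (fun v : EuclideanSpace ℝ (Fin d) => v i) hg
    simpa [column, Matrix.mulVec, dotProduct, mul_comm] using this
  have h1 : g ⬝ᵥ g + Y.mulVec g ⬝ᵥ Y.mulVec g = 0 := by
    have h2 : ((X + Y).transpose * (X + Y)).mulVec g = 0 := by
      rw [← Matrix.mulVec_mulVec, h0, Matrix.mulVec_zero]
    rw [transpose_mul_self_add hX hY, Matrix.add_mulVec, Matrix.one_mulVec,
      ← Matrix.mulVec_mulVec] at h2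
    have h3 := congrArg (fun v => g ⬝ᵥ v) h2
    rwa [dotProduct_add, Matrix.dotProduct_mulVec, Matrix.vecMul_transpose, dotProduct_zero] at h3
  have hn : ∀ v : Fin d → ℝ, 0 ≤ v ⬝ᵥ v := fun v =>
    Finset.sum_nonneg fun i _ => mul_self_nonneg _
  have hg0 : ∑ i, g i * g i ≤ 0 := by
    have := hn (Y.mulVec g)
    change g ⬝ᵥ g ≤ 0
    linarith
  intro i
  have := (Finset.sum_eq_zero_iff_of_nonneg (fun i _ => mul_self_nonneg (g i))).1
    (le_antisymm hg0 (Finset.sum_nonneg fun i _ => mul_self_nonneg (g i))) i (Finset.mem_univ i)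
  exact mul_self_eq_zero.1 this

/-- The Cholesky factor of `1 + YᵀY` differs from `1` by a quantity quadratic in `Y`. -/
theorem abs_sub_one_le_of_cholesky {d : ℕ} {R : Matrix (Fin k) (Fin k) ℝ}
    {Y : Matrix (Fin d) (Fin k) ℝ} (hlow : ∀ i j, j < i → R i j = 0) (hdiag : ∀ i, 0 < R i i)
    (hR : R.transpose * R = 1 + Y.transpose * Y) (i l : Fin k) :
    |(R - 1) i l| ≤ k * ∑ i, ∑ l, Y i l ^ 2 := by
  have htri : R.BlockTriangular id := fun i j h => hlow i j h
  have hdet : IsUnit R.det := by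
    rw [Matrix.det_of_isUpperTriangular htri]
    exact (Finset.prod_pos fun i _ => hdiag i).ne'.isUnit
  have := R.invertibleOfIsUnitDet hdet
  obtain ⟨T, hT⟩ : ∃ T, T = R⁻¹ := ⟨_, rfl⟩
  have hTR : T * R = 1 := hT ▸ Matrix.nonsing_inv_mul R hdet
  have hRT : R * T = 1 := hT ▸ Matrix.mul_nonsing_inv R hdet
  have hTlow : ∀ i j, j < i → T i j = 0 := by
    rw [hT]; exact fun i j h => Matrix.blockTriangular_inv_of_blockTriangular htri h
  have hTtRt : T.transpose * R.transpose = 1 := by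
    rw [← Matrix.transpose_mul, hRT, Matrix.transpose_one]
  have hTdiag : T i i * R i i = 1 := by
    have h := congrFun (congrFun hTR i) i
    rw [Matrix.mul_apply, Matrix.one_apply_eq, Finset.sum_eq_single i] at h
    · exact h
    · intro j _ hj
      rcases lt_or_gt_of_ne hj with h | h
      · rw [hTlow _ _ h, zero_mul]
      · rw [hlow _ _ h, mul_zero]
    · simp
  -- `Tᵀ` is lower triangular, so above the diagonal `R` consists of the quadratic term alone.
  have hRfac : R = T.transpose + T.transpose * (Y.transpose * Y) := by
    have h := congrArg (fun M => T.transpose * M) hR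
    simpa only [← Matrix.mul_assoc, hTtRt, Matrix.one_mul, Matrix.mul_add, Matrix.mul_one]
      using h
  -- This makes the columns of `T` have norm at most one, whatever the size of `Y`.
  have hTT : T.transpose * T + (Y * T).transpose * (Y * T) = 1 := by
    have h := congrArg (fun M => T.transpose * M * T) hR
    simp only [Matrix.mul_add, Matrix.add_mul, Matrix.mul_one] at h
    rw [Matrix.transpose_mul]
    rw [← Matrix.mul_assoc, hTtRt, Matrix.one_mul, hRT] at h
    simpa only [Matrix.mul_assoc] using h.symm
  have hTle : ∀ j, |T j i| ≤ 1 := by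
    intro j
    have h := congrFun (congrFun hTT i) i
    simp only [Matrix.add_apply, Matrix.mul_apply (M := T.transpose),
      Matrix.mul_apply (M := (Y * T).transpose), Matrix.transpose_apply, Matrix.one_apply_eq,
      ← sq] at h
    have h1 : T j i ^ 2 ≤ ∑ j, T j i ^ 2 :=
      Finset.single_le_sum (f := fun j => T j i ^ 2) (fun _ _ => sq_nonneg _) (Finset.mem_univ j)
    have h2 : 0 ≤ ∑ j, (Y * T) j i ^ 2 := Finset.sum_nonneg fun _ _ => sq_nonneg _
    rw [← sq_le_one_iff_abs_le_one]
    linarith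
  have hbound : |(T.transpose * (Y.transpose * Y)) i l| ≤ k * ∑ i, ∑ l, Y i l ^ 2 := by
    rw [Matrix.mul_apply]
    refine (Finset.abs_sum_le_sum_abs _ _).trans ?_
    refine (Finset.sum_le_card_nsmul _ _ (∑ i, ∑ l, Y i l ^ 2) fun j _ => ?_).trans_eq (by simp)
    rw [abs_mul, Matrix.transpose_apply]
    exact (mul_le_of_le_one_left (abs_nonneg _) (hTle j)).trans (abs_transpose_mul_self_le Y j l)
  have hentry := congrFun (congrFun hRfac i) l
  rw [Matrix.add_apply, Matrix.transpose_apply] at hentry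
  refine le_trans ?_ hbound
  rw [Matrix.sub_apply]
  rcases lt_trichotomy i l with h | h | h
  · rw [Matrix.one_apply_ne h.ne, sub_zero, hentry, hTlow _ _ h, zero_add]
  -- As `T i i` and `R i i` are mutually inverse positive numbers, `1` lies between them, so `|R i i
  -- - 1| ≤ |R i i - T i i|`.
  · subst h
    have hr := hdiag i
    have ht : 0 < T i i := by
      by_contra hcon
      nlinarith
    have : (T.transpose * (Y.transpose * Y)) i i = R i i - T i i := by linarith
    rw [this, Matrix.one_apply_eq]
    rcases le_total 1 (R i i) with h1 | h1
    · have : T i i ≤ 1 := by nlinarith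
      rw [abs_of_nonneg (by linarith), abs_of_nonneg (by linarith)]
      linarith
    · have : 1 ≤ T i i := by nlinarith
      rw [abs_of_nonpos (by linarith), abs_of_nonpos (by linarith)]
      linarith
  · rw [Matrix.one_apply_ne h.ne', hlow _ _ h, sub_zero, abs_zero]
    exact abs_nonneg _

/-- The QR retraction agrees with `X + Y` up to a quantity quadratic in `Y`. -/
theorem abs_qf_add_sub_le {d : ℕ} {X Y : Matrix (Fin d) (Fin k) ℝ} (hX : X ∈ stiefel d k)
    (hY : X.transpose * Y + Y.transpose * X = 0) (i : Fin d) (l : Fin k) :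
    |qf (X + Y) i l - (X + Y) i l| ≤ k * (k * ∑ i, ∑ l, Y i l ^ 2) := by
  obtain ⟨hQ, R, hlow, hdiag, hfac⟩ := qf_spec (X + Y) (linearIndependent_column_add hX hY)
  set Q := qf (X + Y)
  have hR : R.transpose * R = 1 + Y.transpose * Y := by
    rw [← transpose_mul_self_add hX hY, hfac, Matrix.transpose_mul, Matrix.mul_assoc,
      ← Matrix.mul_assoc Q.transpose, show Q.transpose * Q = 1 from hQ, Matrix.one_mul]
  -- The entries of `Q` are at most one in absolute value, so the error is controlled by `R - 1`.
  have hdiff : (X + Y) i l - Q i l = (Q * (R - 1) : Matrix (Fin d) (Fin k) ℝ) i l := by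
    rw [Matrix.mul_sub, Matrix.mul_one, ← hfac]
    rfl
  rw [abs_sub_comm, hdiff, Matrix.mul_apply]
  refine (Finset.abs_sum_le_sum_abs _ _).trans ?_
  refine (Finset.sum_le_card_nsmul _ _ (k * ∑ i, ∑ l, Y i l ^ 2) fun j _ => ?_).trans_eq
    (by simp)
  rw [abs_mul]
  exact (mul_le_of_le_one_left (abs_nonneg _) (abs_le_one_of_mem_stiefel hQ i j)).trans
    (abs_sub_one_le_of_cholesky hlow hdiag hR j l)

theorem norm_le_card_mul {ι : Type*} [Fintype ι] {v : EuclideanSpace ℝ ι} {c : ℝ}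
    (hv : ∀ i, |v i| ≤ c) : ‖v‖ ≤ Fintype.card ι * c := by
  classical
  have h : v = ∑ i, v i • EuclideanSpace.single i (1 : ℝ) := by
    ext j
    simp [Finset.sum_apply, Pi.single_apply]
  calc ‖v‖ = ‖∑ i, v i • EuclideanSpace.single i (1 : ℝ)‖ := by rw [← h]
    _ ≤ ∑ i, ‖v i • EuclideanSpace.single i (1 : ℝ)‖ := norm_sum_le _ _
    _ ≤ ∑ _i : ι, c := Finset.sum_le_sum fun i _ => by simpa [norm_smul] using hv i
    _ = _ := by simp

theorem exists_norm_retract_sub_le (m n k : ℕ) : ∃ C : ℝ, 0 ≤ C ∧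
    ∀ p ∈ searchSpace m n k, ∀ ξ ∈ tangentAt p, ‖retract p ξ - (p + ξ)‖ ≤ C * ‖ξ‖ ^ 2 := by
  refine ⟨Fintype.card ((Fin m × Fin k) ⊕ (Fin k ⊕ (Fin n × Fin k))) * (k * k), by positivity,
    fun p hp ξ hξ => ?_⟩
  rw [mul_assoc]
  refine norm_le_card_mul ?_
  rintro (⟨i, l⟩ | l | ⟨j, l⟩)
  · refine (abs_qf_add_sub_le hp.1 hξ.1 i l).trans ?_
    rw [mul_assoc]
    gcongr
    exact sum_compU_sq_le ξ
  · have : (retract p ξ - (p + ξ)) (Sum.inr (Sum.inl l)) = 0 := by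
      simp [retract, mkTriple, compX]
    rw [this, abs_zero]
    positivity
  · refine (abs_qf_add_sub_le hp.2 hξ.2 j l).trans ?_
    rw [mul_assoc]
    gcongr
    exact sum_compV_sq_le ξ

/-! ### The Armijo decrease -/

/-- A `C²` function on a finite-dimensional space is approximated by its linearization up to a
quadratic error, uniformly on balls. -/
theorem exists_abs_sub_fderiv_le {E : Type*} [NormedAddCommGroup E] [NormedSpace ℝ E]
    [FiniteDimensional ℝ E] {f : E → ℝ} (hf : ContDiff ℝ 2 f) (r : ℝ) : ∃ C : ℝ, 0 ≤ C ∧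
      ∀ x ∈ Metric.closedBall (0 : E) r, ∀ y ∈ Metric.closedBall (0 : E) r,
        |f y - f x - fderiv ℝ f x (y - x)| ≤ C * ‖y - x‖ ^ 2 := by
  have hf' : ContDiff ℝ 1 (fderiv ℝ f) := hf.fderiv_right (by norm_num)
  obtain ⟨C, hC⟩ := (isCompact_closedBall (0 : E) r).exists_bound_of_continuousOn
    (f := fderiv ℝ (fderiv ℝ f)) (hf'.continuous_fderiv one_ne_zero).continuousOn
  refine ⟨|C|, abs_nonneg _, fun x hx y hy => ?_⟩
  have hseg : segment ℝ x y ⊆ Metric.closedBall 0 r :=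
    (convex_closedBall (0 : E) r).segment_subset hx hy
  rw [sq, ← mul_assoc]
  -- The mean value inequality is used twice: the second derivative bound makes the derivative
  -- Lipschitz on the ball, and on the segment the derivative then varies by at most `|C| ‖y - x‖`.
  refine (convex_segment x y).norm_image_sub_le_of_norm_fderiv_le'
    (fun z _ => (hf.differentiable two_ne_zero) z) (fun z hz => ?_)
    (left_mem_segment ℝ x y) (right_mem_segment ℝ x y)
  have h1 : ‖fderiv ℝ f z - fderiv ℝ f x‖ ≤ |C| * ‖z - x‖ :=
    (convex_closedBall (0 : E) r).norm_image_sub_le_of_norm_fderiv_le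
      (fun w _ => (hf'.differentiable one_ne_zero) w)
      (fun w hw => (hC w hw).trans (le_abs_self C)) hx (hseg hz)
  refine h1.trans (mul_le_mul_of_nonneg_left ?_ (abs_nonneg C))
  exact norm_sub_le_of_mem_segment hz

/-- Along the QR retraction, a `C²` function is bounded by its Riemannian linearization plus a
quadratic error, uniformly on compact sets and for bounded tangent vectors. -/
theorem exists_retract_le {f : Ambient m n k → ℝ} (hf : ContDiff ℝ 2 f)
    {K : Set (Ambient m n k)} (hK : IsCompact K) (hKs : K ⊆ searchSpace m n k) (r : ℝ) :
    ∃ C : ℝ, 0 < C ∧ ∀ p ∈ K, ∀ ξ ∈ tangentAt p, ‖ξ‖ ≤ r →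
      f (retract p ξ) ≤ f p + ⟪riemGrad f p, ξ⟫ + C * ‖ξ‖ ^ 2 := by
  obtain ⟨C₁, hC₁, hret⟩ := exists_norm_retract_sub_le m n k
  obtain ⟨ρ, hρ⟩ := hK.isBounded.exists_norm_le
  obtain ⟨M, hM⟩ := hK.exists_bound_of_continuousOn
    (hf.continuous_fderiv two_ne_zero).continuousOn
  -- A ball of this radius contains both `p` and `retract p ξ`.
  obtain ⟨C₂, hC₂, hquad⟩ := exists_abs_sub_fderiv_le hf (|ρ| + |r| + C₁ * r ^ 2)
  -- The first term pays for the derivative applied to the retraction error, the second for the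
  -- Taylor remainder; the `1` only makes the constant positive, hence a valid divisor.
  refine ⟨|M| * C₁ + C₂ * (1 + C₁ * |r|) ^ 2 + 1, by positivity, fun p hp ξ hξ hξr => ?_⟩
  have hr : ‖ξ‖ ≤ |r| := hξr.trans (le_abs_self r)
  set e := retract p ξ - (p + ξ) with he
  have hee : ‖e‖ ≤ C₁ * ‖ξ‖ ^ 2 := hret p (hKs hp) ξ hξ
  have hsq : ‖ξ‖ ^ 2 ≤ r ^ 2 := by rw [← sq_abs r]; gcongr
  have hsub : retract p ξ - p = ξ + e := by rw [he]; abel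
  have hpr : ‖p‖ ≤ |ρ| := (hρ p hp).trans (le_abs_self ρ)
  have hp0 : p ∈ Metric.closedBall (0 : Ambient m n k) (|ρ| + |r| + C₁ * r ^ 2) := by
    rw [mem_closedBall_zero_iff]
    have : 0 ≤ |r| + C₁ * r ^ 2 := by positivity
    linarith
  have hstep : ‖ξ + e‖ ≤ (1 + C₁ * |r|) * ‖ξ‖ := by
    have : C₁ * ‖ξ‖ ^ 2 ≤ C₁ * |r| * ‖ξ‖ := by
      rw [sq, mul_assoc]
      gcongr
    linarith [norm_add_le ξ e]
  have hq0 : retract p ξ ∈ Metric.closedBall (0 : Ambient m n k) (|ρ| + |r| + C₁ * r ^ 2) := by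
    rw [mem_closedBall_zero_iff]
    have h1 : retract p ξ = p + ξ + e := by rw [he]; abel
    have h2 : C₁ * ‖ξ‖ ^ 2 ≤ C₁ * r ^ 2 := by gcongr
    rw [h1]
    linarith [norm_add₃_le (a := p) (b := ξ) (c := e)]
  have h := (abs_le.1 (hquad p hp0 _ hq0)).2
  rw [hsub, map_add, ← inner_riemGrad f p hξ] at h
  have hlin : fderiv ℝ f p e ≤ |M| * (C₁ * ‖ξ‖ ^ 2) :=
    (le_abs_self _).trans (((fderiv ℝ f p).le_opNorm e).trans
      (mul_le_mul ((hM p hp).trans (le_abs_self M)) hee (norm_nonneg _) (abs_nonneg _)))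
  have hq : C₂ * ‖ξ + e‖ ^ 2 ≤ C₂ * ((1 + C₁ * |r|) * ‖ξ‖) ^ 2 := by gcongr
  nlinarith [sq_nonneg ‖ξ‖]

theorem norm_riemGrad_le (f : Ambient m n k → ℝ) (p : Ambient m n k) :
    ‖riemGrad f p‖ ≤ ‖fderiv ℝ f p‖ := by
  refine (Submodule.norm_starProjection_apply_le _ _).trans_eq ?_
  rw [gradient, LinearIsometryEquiv.norm_map]

/-- On a compact set, the Armijo step along the negative Riemannian gradient decreases a `C²`
function by at least a fixed multiple of the squared norm of the gradient. -/
theorem exists_armijo_decrease {f : Ambient m n k → ℝ} (hf : ContDiff ℝ 2 f)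
    {K : Set (Ambient m n k)} (hK : IsCompact K) (hKs : K ⊆ searchSpace m n k) {α β ι : ℝ}
    (hα : 0 < α) (hβ : β ∈ Set.Ioo (0 : ℝ) 1) (hι : ι ∈ Set.Ioo (0 : ℝ) 1) :
    ∃ δ : ℝ, 0 < δ ∧ ∀ p ∈ K, δ * ‖riemGrad f p‖ ^ 2 ≤
      f p - f (retract p (-(armijoStep f α β ι p (-riemGrad f p)) • riemGrad f p)) := by
  obtain ⟨M, hM⟩ := hK.exists_bound_of_continuousOn
    (hf.continuous_fderiv two_ne_zero).continuousOn
  -- Trial steps are at most `α` and gradients at most `M`, so `α * M` bounds every trial vector.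
  obtain ⟨C, hC, hret⟩ := exists_retract_le hf hK hKs (α * M)
  -- A step `s` decreases `f` by at least `(s - C s²)‖g‖²`, which is at least `ι s ‖g‖²` once `C s ≤
  -- 1 - ι`.
  obtain ⟨s₀, hs₀⟩ : ∃ s₀, s₀ = (1 - ι) / C := ⟨_, rfl⟩
  have hs₀pos : 0 < s₀ := hs₀ ▸ div_pos (sub_pos.2 hι.2) hC
  refine ⟨ι * min α (β * s₀), mul_pos hι.1 (lt_min hα (mul_pos hβ.1 hs₀pos)), fun p hp => ?_⟩
  set g := riemGrad f p with hg
  have hmem : ∀ N : ℕ, β ^ N * α ≤ s₀ → N ∈ armijoExponents f α β ι p (-g) := by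
    intro N hN
    obtain ⟨s, hs⟩ : ∃ s, s = β ^ N * α := ⟨_, rfl⟩
    have hs0 : 0 < s := hs ▸ mul_pos (pow_pos hβ.1 N) hα
    have hsα : s ≤ α := hs ▸ mul_le_of_le_one_left hα.le (pow_le_one₀ hβ.1.le hβ.2.le)
    change f p - f (retract p ((β ^ N * α) • (-g))) ≥ -ι * ⟪g, (β ^ N * α) • (-g)⟫
    rw [← hs] at hN ⊢
    have hnorm : ‖s • (-g)‖ = s * ‖g‖ := by
      rw [norm_smul, norm_neg, Real.norm_of_nonneg hs0.le]
    have hinner : ⟪g, s • (-g)⟫ = -(s * ‖g‖ ^ 2) := by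
      rw [real_inner_smul_right, inner_neg_right, real_inner_self_eq_norm_sq, mul_neg]
    have h := hret p hp (s • (-g)) (Submodule.smul_mem _ _ (neg_mem (riemGrad_mem f p))) (by
      rw [hnorm]
      exact mul_le_mul hsα ((norm_riemGrad_le f p).trans (hM p hp)) (norm_nonneg _) hα.le)
    rw [hnorm, ← hg, hinner] at h
    rw [hinner]
    have hsC : s * C ≤ 1 - ι := by rwa [hs₀, le_div_iff₀ hC] at hN
    have := mul_le_mul_of_nonneg_right hsC (mul_nonneg hs0.le (sq_nonneg ‖g‖))
    nlinarith
  -- Without this, `sInf` could be the default value `0` of the empty set instead of an accepted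
  -- exponent.
  have hne : (armijoExponents f α β ι p (-g)).Nonempty := by
    obtain ⟨N, hN⟩ := exists_pow_lt_of_lt_one (div_pos hs₀pos hα) hβ.2
    exact ⟨N, hmem N ((lt_div_iff₀ hα).1 hN).le⟩
  obtain ⟨N, hN⟩ : ∃ N, N = sInf (armijoExponents f α β ι p (-g)) := ⟨_, rfl⟩
  have hNmem : N ∈ armijoExponents f α β ι p (-g) := hN ▸ Nat.sInf_mem hne
  -- Either the initial step `α` is accepted, or the preceding exponent was rejected and so had a
  -- step larger than `s₀`.
  have hstep : min α (β * s₀) ≤ β ^ N * α := by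
    cases N with
    | zero => simp
    | succ N =>
      have : N ∉ armijoExponents f α β ι p (-g) := Nat.notMem_of_lt_sInf (hN ▸ N.lt_succ_self)
      have hlt : s₀ < β ^ N * α := not_le.1 fun hle => this (hmem N hle)
      refine (min_le_right _ _).trans ?_
      rw [pow_succ', mul_assoc]
      exact mul_le_mul_of_nonneg_left hlt.le hβ.1.le
  have hdec : f p - f (retract p ((β ^ N * α) • (-g))) ≥ -ι * ⟪g, (β ^ N * α) • (-g)⟫ := hNmem
  rw [real_inner_smul_right, inner_neg_right, real_inner_self_eq_norm_sq] at hdec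
  rw [armijoStep, ← hN, neg_smul, ← smul_neg]
  refine le_trans ?_ hdec
  have := mul_le_mul_of_nonneg_left (mul_le_mul_of_nonneg_right hstep (sq_nonneg ‖g‖)) hι.1.le
  linarith

/-! ### Limits of almost critical points -/

/-- A map that sends ambient vectors to tangent vectors of `V_k(ℝ^d)` and fixes tangent
vectors. -/
noncomputable def stiefelProj {d : ℕ} (X Z : Matrix (Fin d) (Fin k) ℝ) :
    Matrix (Fin d) (Fin k) ℝ :=
  Z - (2⁻¹ : ℝ) • (X * (X.transpose * Z + Z.transpose * X))

/-- With `S = XᵀZ + ZᵀX` symmetric and `XᵀX = 1`, the correction removes `S/2` from each of the two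
summands. -/
theorem stiefelProj_tangent {d : ℕ} {X : Matrix (Fin d) (Fin k) ℝ} (hX : X ∈ stiefel d k)
    (Z : Matrix (Fin d) (Fin k) ℝ) :
    X.transpose * stiefelProj X Z + (stiefelProj X Z).transpose * X = 0 := by
  have hX' : X.transpose * X = 1 := hX
  obtain ⟨S, hS⟩ : ∃ S, S = X.transpose * Z + Z.transpose * X := ⟨_, rfl⟩
  have hSt : S.transpose = S := by
    rw [hS, Matrix.transpose_add, Matrix.transpose_mul, Matrix.transpose_mul,
      Matrix.transpose_transpose, Matrix.transpose_transpose, add_comm]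
  have h1 : X.transpose * stiefelProj X Z = X.transpose * Z - (2⁻¹ : ℝ) • S := by
    rw [stiefelProj, ← hS, Matrix.mul_sub, Matrix.mul_smul, ← Matrix.mul_assoc, hX',
      Matrix.one_mul]
  have h2 : (stiefelProj X Z).transpose * X = Z.transpose * X - (2⁻¹ : ℝ) • S := by
    rw [stiefelProj, ← hS, Matrix.transpose_sub, Matrix.sub_mul, Matrix.transpose_smul,
      Matrix.smul_mul, Matrix.transpose_mul, Matrix.mul_assoc, hX', Matrix.mul_one, hSt]
  rw [h1, h2, hS]
  module

theorem stiefelProj_of_tangent {d : ℕ} {X Z : Matrix (Fin d) (Fin k) ℝ}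
    (hZ : X.transpose * Z + Z.transpose * X = 0) : stiefelProj X Z = Z := by
  rw [stiefelProj, hZ, Matrix.mul_zero, smul_zero, sub_zero]

/-- A map that sends ambient vectors to tangent vectors at `p` and fixes tangent vectors. -/
noncomputable def tangentProj (v p : Ambient m n k) : Ambient m n k :=
  mkTriple (stiefelProj (compU p) (compU v)) (compX v) (stiefelProj (compV p) (compV v))

theorem tangentProj_mem {p : Ambient m n k} (hp : p ∈ searchSpace m n k) (v : Ambient m n k) :
    tangentProj v p ∈ tangentAt p :=
  ⟨stiefelProj_tangent hp.1 _, stiefelProj_tangent hp.2 _⟩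

theorem tangentProj_of_mem {p v : Ambient m n k} (hv : v ∈ tangentAt p) :
    tangentProj v p = v := by
  rw [tangentProj, stiefelProj_of_tangent hv.1, stiefelProj_of_tangent hv.2]
  ext (_ | _ | _) <;> rfl

theorem continuous_tangentProj (v : Ambient m n k) : Continuous (tangentProj v) := by
  refine (PiLp.continuous_toLp 2 _).comp (continuous_pi ?_)
  have hU := continuous_compU (m := m) (n := n) (k := k)
  have hV := continuous_compV (m := m) (n := n) (k := k)
  rintro (⟨i, l⟩ | l | ⟨j, l⟩)
  · have : Continuous fun p : Ambient m n k => stiefelProj (compU p) (compU v) := by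
      unfold stiefelProj
      fun_prop
    exact this.matrix_elem i l
  · exact continuous_const
  · have : Continuous fun p : Ambient m n k => stiefelProj (compV p) (compV v) := by
      unfold stiefelProj
      fun_prop
    exact this.matrix_elem j l

/-- This avoids proving that the projection onto the moving tangent space is continuous. The vector
`v = riemGrad f p` is extended to the continuous tangent field `tangentProj v`; pairing it with the
gradients at `y t` gives a limit that is both `0` and `fderiv ℝ f p v = ‖v‖²`. -/
theorem isCriticalPoint_of_tendsto {f : Ambient m n k → ℝ} (hf : ContDiff ℝ 2 f)
    {y : ℕ → Ambient m n k} {p : Ambient m n k} (hy : ∀ t, y t ∈ searchSpace m n k)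
    (hyp : Filter.Tendsto y Filter.atTop (nhds p))
    (hgrad : Filter.Tendsto (fun t => ‖riemGrad f (y t)‖) Filter.atTop (nhds 0)) :
    IsCriticalPoint f p := by
  refine ⟨isClosed_searchSpace.mem_of_tendsto hyp (Filter.Eventually.of_forall hy), ?_⟩
  obtain ⟨v, hv⟩ : ∃ v, v = riemGrad f p := ⟨_, rfl⟩
  have hvp : v ∈ tangentAt p := hv ▸ riemGrad_mem f p
  have hproj : Filter.Tendsto (fun t => tangentProj v (y t)) Filter.atTop (nhds v) := by
    have := ((continuous_tangentProj v).tendsto p).comp hyp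
    rwa [tangentProj_of_mem hvp] at this
  have h1 : Filter.Tendsto (fun t => ⟪riemGrad f (y t), tangentProj v (y t)⟫) Filter.atTop
      (nhds 0) := by
    have := (tendsto_zero_iff_norm_tendsto_zero.2 hgrad).inner (𝕜 := ℝ) hproj
    rwa [inner_zero_left] at this
  have h2 : Filter.Tendsto (fun t => ⟪riemGrad f (y t), tangentProj v (y t)⟫) Filter.atTop
      (nhds (fderiv ℝ f p v)) := by
    simp only [fun t => inner_riemGrad f (y t) (tangentProj_mem (hy t) v)]
    have hfd : Filter.Tendsto (fun t => fderiv ℝ f (y t)) Filter.atTop (nhds (fderiv ℝ f p)) :=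
      ((hf.continuous_fderiv two_ne_zero).tendsto p).comp hyp
    exact (isBoundedBilinearMap_apply.continuous.tendsto (fderiv ℝ f p, v)).comp
      (hfd.prodMk_nhds hproj)
  have h3 := tendsto_nhds_unique h1 h2
  rw [← inner_riemGrad f p hvp, hv, real_inner_self_eq_norm_sq] at h3
  exact norm_eq_zero.1 (pow_eq_zero_iff two_ne_zero |>.1 h3.symm)

/-- A nonnegative sequence of values that decreases by at least `δ aₜ²` forces `aₜ → 0`. -/
theorem tendsto_zero_of_sq_le_sub {u a : ℕ → ℝ} {δ : ℝ} (hδ : 0 < δ) (hu : ∀ t, 0 ≤ u t)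
    (ha : ∀ t, 0 ≤ a t) (h : ∀ t, δ * a t ^ 2 ≤ u t - u (t + 1)) :
    Filter.Tendsto a Filter.atTop (nhds 0) := by
  have hanti : Antitone u := antitone_nat_of_succ_le fun t => by
    have := h t
    have : 0 ≤ δ * a t ^ 2 := by positivity
    linarith
  have hlim := tendsto_atTop_ciInf hanti ⟨0, by rintro _ ⟨t, rfl⟩; exact hu t⟩
  -- Consecutive differences of a convergent sequence tend to zero and dominate `δ aₜ²`.
  have hdiff := (hlim.sub (hlim.comp (Filter.tendsto_add_atTop_nat 1))).div_const δ
  rw [sub_self, zero_div] at hdiff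
  have hsq : Filter.Tendsto (fun t => a t ^ 2) Filter.atTop (nhds 0) :=
    squeeze_zero (fun t => sq_nonneg _) (fun t => by
      rw [Function.comp_apply, le_div_iff₀ hδ, mul_comm]
      exact h t) hdiff
  simpa [Real.sqrt_sq (ha _)] using hsq.sqrt

end StiefelWLRA

open StiefelWLRA in
theorem propositionE2 (m n k : ℕ) (hk : 0 < k) (hkmn : k ≤ min m n)
    (A W : Matrix (Fin m) (Fin n) ℝ)
    (hW : ∀ i j, 0 < W i j) (hWsum : ∑ i, ∑ j, W i j = 1)
    (α β ι : ℝ) (hα : 0 < α) (hβ : β ∈ Set.Ioo (0 : ℝ) 1) (hι : ι ∈ Set.Ioo (0 : ℝ) 1)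
    (z : ℕ → StiefelWLRA.Ambient m n k)
    (hz : StiefelWLRA.IsLineSearchSequence (StiefelWLRA.costG A W) α β ι z) :
    (∀ c : ℝ, IsCompact {p ∈ StiefelWLRA.searchSpace m n k | StiefelWLRA.costG A W p ≤ c} ∧
      ∀ p ∈ StiefelWLRA.searchSpace m n k, StiefelWLRA.costG A W p ≤ c →
        ‖StiefelWLRA.compX p‖ ≤
          StiefelWLRA.frobNorm A + √(c / StiefelWLRA.minWeight W)) ∧
    Filter.Tendsto (fun t => ‖StiefelWLRA.riemGrad (StiefelWLRA.costG A W) (z t)‖)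
      Filter.atTop (nhds 0) ∧
    ∃ (φ : ℕ → ℕ) (p : StiefelWLRA.Ambient m n k), StrictMono φ ∧
      Filter.Tendsto (fun s => z (φ s)) Filter.atTop (nhds p) ∧
      StiefelWLRA.IsCriticalPoint (StiefelWLRA.costG A W) p := by
  -- From `0 < k ≤ min m n`; nonempty index sets make `minWeight W` an attained, positive minimum.
  have : NeZero m := ⟨by lia⟩
  have : NeZero n := ⟨by lia⟩
  have hK := isCompact_sublevel (k := k) A hW (costG A W (z 0))
  have hcd := contDiff_costG (k := k) A W
  obtain ⟨hmem, hdec⟩ := hz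
  obtain ⟨δ, hδ, hδK⟩ := exists_armijo_decrease hcd hK (fun p hp => hp.1) hα hβ hι
  -- The decrease estimate is available only on this compact set, so invariance is proved by
  -- induction: the estimate at `z t` keeps `z (t + 1)` inside.
  have hzK : ∀ t, z t ∈ {p ∈ searchSpace m n k | costG A W p ≤ costG A W (z 0)} := by
    intro t
    induction t with
    | zero => exact ⟨hmem 0, le_rfl⟩
    | succ t ih =>
      have h1 := (hδK _ ih).trans (hdec t)
      have h2 : 0 ≤ δ * ‖riemGrad (costG A W) (z t)‖ ^ 2 := by positivity
      exact ⟨hmem _, by linarith [ih.2]⟩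
  have hgrad : Filter.Tendsto (fun t => ‖riemGrad (costG A W) (z t)‖) Filter.atTop (nhds 0) :=
    tendsto_zero_of_sq_le_sub hδ (fun t => costG_nonneg hW (z t)) (fun t => norm_nonneg _)
      fun t => (hδK _ (hzK t)).trans (hdec t)
  refine ⟨fun c => ⟨isCompact_sublevel A hW c, fun p hp hc => norm_compX_le A hW hp hc⟩,
    hgrad, ?_⟩
  obtain ⟨p, -, φ, hφ, hlim⟩ := hK.tendsto_subseq hzK
  exact ⟨φ, p, hφ, hlim, isCriticalPoint_of_tendsto hcd (fun t => hmem (φ t)) hlim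
    (hgrad.comp hφ.tendsto_atTop)⟩
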